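/- Fix integers $n\ge 1$, $d\ge 0$, $m\ge 0$. A record is a pair $(x,y)$ with $x\in\mathbb R^d$, $\|x\|_2=1$, $y\in\{-1,1\}$; a database $D$ is an $n$-tuple of records, and two databases are neighbours if they differ in the value of at most one record. A randomized mechanism $\mathcal M$ satisfies $\epsilon$-differential privacy if $\Pr(\mathcal M(D)\in V)\le e^{\epsilon}\Pr(\mathcal M(D')\in V)$ for all neighbours $D,D'$ and all measurable $V$; it satisfies $\rho$-zCDP if $D_a(\mathcal M(D)\|\mathcal M(D'))\le\rho a$ for all neighbours $D,D'$ and all $a\in(1,\infty)$, where $D_a$ is the Rényi divergence of order $a$. The $L_2$-sensitivity of a vector- or matrix-valued function $g$ of the database is $\sup\|g(D)-g(D')\|_2$ over neighbours (for matrices: the Euclidean norm of the vector of entries). For $s\ge0$ and $\phi>0$ let $\nu_k(s,\phi)$ be the following law on $\mathbb R^k$. In the DP variant it has density proportional to $e^{-\gamma\|\beta\|_2}$ with $\gamma=\phi/s$ (and is the point mass at $0$ if $s=0$); in the zCDP variant it is $N(0,\frac{s^2}{2\phi}I_k)$. For a real $d\times d$ matrix $M$, $\mathrm{PrivSPDMat}(M,s,\phi,c)$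 adds to the entries of $M$ a noise vector drawn from $\nu_{d^2}(s,\phi)$, replaces the result by its symmetric part, and replaces each eigenvalue $\lambda$ of that symmetric matrix by $\max(\lambda,2c)$, keeping the eigenvectors. Let $f:\mathbb R\to\mathbb R$ be convex and differentiable with $|f'|\le 1$, put $f(x,y,\theta)=f(y\,\theta^Tx)$, and let $c,\phi_1,\phi_2,\phi_3>0$ and $\alpha\in(0,1)$. Let $H[f(x,y,\theta)]$ denote the Hessian in $\theta$; at points $\theta$ where $\theta\mapsto f(x,y,\theta)$ is not twice differentiable, any fixed value, measurable in $\theta$, is used. For $\theta\in\mathbb R^d$ put $$H_D(\theta)=\frac1n\sum_{i=1}^n H[f(x_i,y_i,\theta)]+2cI,\qquad \Sigma_D(\theta)=\frac1n\sum_{i=1}^n\nabla_\theta f(x_i,y_i,\theta)\,\nabla_\theta f(x_i,y_i,\theta)^T-4c^2\theta\theta^T ,$$ and let $s_H(\theta),s_\Sigma(\theta)\in[0,\infty)$ be measurable in $\theta$ and at least (for instance, equal to) the $L_2$-sensitivities of $D\mapsto H_D(\theta)$ and $D\mapsto\Sigma_D(\theta)$, respectively; in particular these sensitivities are assumed finite.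 The confidence-interval algorithm for output perturbation, on input $D$, does the following. 1. Output perturbation: $\tilde\theta=\arg\min_\theta\frac1n\sum_{i=1}^n\left[f(x_i,y_i,\theta)+c\|\theta\|_2^2\right]+\beta$ with $\beta\sim\nu_d\!\left(\frac1{nc},\phi_1\right)$, i.e. density proportional to $e^{-nc\phi_1\|\beta\|_2}$ in the DP variant and $N\!\left(0,\frac{1}{2n^2c^2\phi_1}I_d\right)$ in the zCDP variant. 2. $\tilde H=\mathrm{PrivSPDMat}(H_D(\tilde\theta),s_H(\tilde\theta),\phi_2,c)$ and $\tilde\Sigma=\mathrm{PrivSPDMat}(\Sigma_D(\tilde\theta),s_\Sigma(\tilde\theta),\phi_3,c)$, with independent noise. 3. Draw $G_1,\dots,G_m$ i.i.d. from $N(0,\tilde\Sigma)$ and $\beta_1,\dots,\beta_m$ i.i.d. with the law of the noise in step 1 (all fresh and independent), and set $\theta^{(i)}=\tilde\theta+\tilde H^{-1}G_i/\sqrt n-\beta_i$. 4. For each coordinate $j$, let $[\theta_L[j],\theta_R[j]]$ be an interval that covers at least a fraction $1-\alpha$ of $\theta^{(1)}[j],\dots,\theta^{(m)}[j]$, chosen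 by any fixed measurable rule. Output $(\theta_L,\theta_R)$. Then the DP variant of this algorithm satisfies $(\phi_1+\phi_2+\phi_3)$-differential privacy, and its zCDP variant satisfies $(\phi_1+\phi_2+\phi_3)$-zCDP. -/

import Mathlib

open MeasureTheory ProbabilityTheory
open scoped ENNReal NNReal

noncomputable section

namespace DPCI

/-- A record: a feature vector of Euclidean norm one and a label in `{-1, 1}`. -/
structure Record (d : ℕ) where
  x : EuclideanSpace ℝ (Fin d)
  y : ℝ
  norm_x : ‖x‖ = 1
  y_mem : y = 1 ∨ y = -1

/-- A database of `n` records. -/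
abbrev Database (n d : ℕ) : Type := Fin n → Record d

/-- Two databases are neighbours if they differ in the value of (at most) one record. -/
def Neighbor {n d : ℕ} (D D' : Database n d) : Prop :=
  ∃ i, ∀ j, j ≠ i → D j = D' j

/-- A randomized mechanism, given by its output laws, satisfies pure `ε`-differential privacy. -/
structure IsDifferentiallyPrivate {n d : ℕ} {Ω : Type*} [MeasurableSpace Ω]
    (ε : ℝ) (M : Database n d → Measure Ω) : Prop where
  isProbabilityMeasure : ∀ D, IsProbabilityMeasure (M D)
  le : ∀ D D', Neighbor D D' → ∀ V : Set Ω, MeasurableSet V →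
    M D V ≤ ENNReal.ofReal (Real.exp ε) * M D' V

open Classical in
/-- The Rényi divergence `D_a(P ‖ Q) = (a - 1)⁻¹ log ∫ (dP/dQ)^a dQ` of order `a > 1`;
it is `⊤` if `P` is not absolutely continuous with respect to `Q`. -/
def renyiDiv {Ω : Type*} [MeasurableSpace Ω] (a : ℝ) (P Q : Measure Ω) : EReal :=
  if P ≪ Q then
    (((a - 1)⁻¹ : ℝ) : EReal) * ENNReal.log (∫⁻ ω, (P.rnDeriv Q ω) ^ a ∂Q)
  else ⊤

/-- A randomized mechanism satisfies `ρ`-zero-concentrated differential privacy. -/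
structure IsZCDP {n d : ℕ} {Ω : Type*} [MeasurableSpace Ω]
    (ρ : ℝ) (M : Database n d → Measure Ω) : Prop where
  isProbabilityMeasure : ∀ D, IsProbabilityMeasure (M D)
  le : ∀ D D', Neighbor D D' → ∀ a : ℝ, 1 < a →
    renyiDiv a (M D) (M D') ≤ ((ρ * a : ℝ) : EReal)

/-- The `L₂`-sensitivity of a vector-valued function of the database. -/
def l2Sensitivity {n d : ℕ} {ι : Type*} [Fintype ι]
    (g : Database n d → EuclideanSpace ℝ ι) : ℝ≥0∞ :=
  ⨆ (D : Database n d) (D' : Database n d) (_ : Neighbor D D'), edist (g D) (g D')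

/-- The privacy notion that the algorithms are asked to protect. -/
inductive PrivacyMode
  | pureDP
  | zCDP

/-- The spherical Laplace law, with density proportional to `exp (-γ ‖β‖₂)`. -/
def sphericalLaplace (ι : Type*) [Fintype ι] (γ : ℝ) : Measure (EuclideanSpace ℝ ι) :=
  (∫⁻ β : EuclideanSpace ℝ ι, ENNReal.ofReal (Real.exp (-γ * ‖β‖)))⁻¹ •
    (volume : Measure (EuclideanSpace ℝ ι)).withDensity
      (fun β => ENNReal.ofReal (Real.exp (-γ * ‖β‖)))

/-- The isotropic normal law `N(0, v I)`. -/
def isotropicGaussian (ι : Type*) [Fintype ι] (v : ℝ≥0) : Measure (EuclideanSpace ℝ ι) :=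
  (Measure.pi (fun _ : ι => gaussianReal 0 v)).map (WithLp.toLp 2)

open Classical in
/-- The privacy noise for `L₂`-sensitivity `s` and budget `φ`: spherical Laplace with
`γ = φ / s`, respectively `N(0, s² / (2 φ) I)`. For `s = 0` no noise is added. -/
def privacyNoise (mode : PrivacyMode) (ι : Type*) [Fintype ι] (s : ℝ≥0) (φ : ℝ) :
    Measure (EuclideanSpace ℝ ι) :=
  match mode with
  | .pureDP => if s = 0 then Measure.dirac 0 else sphericalLaplace ι (φ / s)
  | .zCDP => isotropicGaussian ι (Real.toNNReal ((s : ℝ) ^ 2 / (2 * φ)))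

/-- The loss of a parameter vector `θ` on a record: `f (y θᵀ x)`. -/
def loss {d : ℕ} (f : ℝ → ℝ) (r : Record d) (θ : EuclideanSpace ℝ (Fin d)) : ℝ :=
  f (r.y * inner ℝ θ r.x)

/-- The regularized empirical risk `(1/n) ∑ᵢ [f (yᵢ θᵀ xᵢ) + c ‖θ‖²]`. -/
def empiricalRisk {n d : ℕ} (f : ℝ → ℝ) (c : ℝ) (D : Database n d)
    (θ : EuclideanSpace ℝ (Fin d)) : ℝ :=
  (1 / (n : ℝ)) * ∑ i, (loss f (D i) θ + c * ‖θ‖ ^ 2)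

/-- The empirical risk minimizer (it exists and is unique for convex `f` and `c > 0`). -/
def erm {n d : ℕ} (f : ℝ → ℝ) (c : ℝ) (D : Database n d) : EuclideanSpace ℝ (Fin d) :=
  Classical.epsilon (fun θ => IsMinOn (empiricalRisk f c D) Set.univ θ)

/-- The noise of output perturbation: privacy noise for sensitivity `1 / (n c)`, that is,
spherical Laplace noise with `γ = n c φ`, respectively `N(0, 1 / (2 n² c² φ) I)`. -/
def outputNoise (mode : PrivacyMode) (n d : ℕ) (c φ : ℝ) :
    Measure (EuclideanSpace ℝ (Fin d)) :=
  privacyNoise mode (Fin d) (Real.toNNReal (1 / (n * c))) φ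

/-- Output perturbation: release the empirical risk minimizer plus noise. -/
def outputPerturb {n d : ℕ} (mode : PrivacyMode) (f : ℝ → ℝ) (c φ : ℝ) (D : Database n d) :
    Measure (EuclideanSpace ℝ (Fin d)) :=
  (outputNoise mode n d c φ).map (fun β => erm f c D + β)

/-- Matrices carry the product (Borel) σ-algebra of their entries. -/
instance matrixMeasurableSpace (d : ℕ) : MeasurableSpace (Matrix (Fin d) (Fin d) ℝ) :=
  inferInstanceAs (MeasurableSpace (Fin d → Fin d → ℝ))

/-- The vector of entries of a matrix. -/
def toVec {d : ℕ} (M : Matrix (Fin d) (Fin d) ℝ) : EuclideanSpace ℝ (Fin d × Fin d) :=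
  WithLp.toLp 2 (fun p => M p.1 p.2)

/-- Reshape a `d²`-dimensional vector to a `d × d` matrix. -/
def toMat {d : ℕ} (η : EuclideanSpace ℝ (Fin d × Fin d)) : Matrix (Fin d) (Fin d) ℝ :=
  Matrix.of (fun i j => η (i, j))

/-- The symmetric part `(M + Mᵀ) / 2`. -/
def symmPart {d : ℕ} (M : Matrix (Fin d) (Fin d) ℝ) : Matrix (Fin d) (Fin d) ℝ :=
  (1 / 2 : ℝ) • (M + M.transpose)

theorem symmPart_isHermitian {d : ℕ} (M : Matrix (Fin d) (Fin d) ℝ) :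
    (symmPart M).IsHermitian := by
  ext i j
  simp [symmPart, mul_add, add_comm]

/-- Symmetrize `M`, take an orthonormal eigen-decomposition `V diag(Λ) Vᵀ`, and replace every
eigenvalue by its maximum with `2 c`. -/
def clipSPD {d : ℕ} (c : ℝ) (M : Matrix (Fin d) (Fin d) ℝ) : Matrix (Fin d) (Fin d) ℝ :=
  let h := symmPart_isHermitian M
  let V : Matrix (Fin d) (Fin d) ℝ := h.eigenvectorUnitary
  V * Matrix.diagonal (fun i => max (h.eigenvalues i) (2 * c)) * V.transpose

/-- The algorithm `PrivSPDMat`: add noise to the entries, then symmetrize and clip. -/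
def privSPDMat {d : ℕ} (mode : PrivacyMode) (M : Matrix (Fin d) (Fin d) ℝ) (s : ℝ≥0)
    (φ c : ℝ) : Measure (Matrix (Fin d) (Fin d) ℝ) :=
  (privacyNoise mode (Fin d × Fin d) s φ).map (fun η => clipSPD c (M + toMat η))

/-- The Hessian matrix of `g` at `θ`. -/
def hessian {d : ℕ} (g : EuclideanSpace ℝ (Fin d) → ℝ) (θ : EuclideanSpace ℝ (Fin d)) :
    Matrix (Fin d) (Fin d) ℝ :=
  Matrix.of (fun j k => (fderiv ℝ (gradient g) θ (EuclideanSpace.single k 1)) j)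

/-- `hess` is a version of the Hessian of the loss: it is the Hessian wherever the loss is twice
differentiable in `θ`, and it follows an arbitrary measurable convention elsewhere (a convex loss
`f` fails to be twice differentiable at most on a null set). -/
structure IsLossHessian {d : ℕ} (f : ℝ → ℝ)
    (hess : Record d → EuclideanSpace ℝ (Fin d) → Matrix (Fin d) (Fin d) ℝ) : Prop where
  measurable : ∀ r, Measurable (hess r)
  eq_hessian : ∀ r θ, DifferentiableAt ℝ (gradient (loss f r)) θ →
    hess r θ = hessian (loss f r) θ

/-- The Hessian of the empirical risk: `(1/n) ∑ᵢ H[f(xᵢ, yᵢ, θ)] + 2 c I`. -/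
def riskHessian {n d : ℕ}
    (hess : Record d → EuclideanSpace ℝ (Fin d) → Matrix (Fin d) (Fin d) ℝ) (c : ℝ)
    (θ : EuclideanSpace ℝ (Fin d)) (D : Database n d) : Matrix (Fin d) (Fin d) ℝ :=
  (1 / (n : ℝ)) • ∑ i, hess (D i) θ + (2 * c) • (1 : Matrix (Fin d) (Fin d) ℝ)

/-- The estimated covariance matrix
`(1/n) ∑ᵢ ∇f(xᵢ, yᵢ, θ) ∇f(xᵢ, yᵢ, θ)ᵀ - 4 c² θ θᵀ`. -/
def gradCovariance {n d : ℕ} (f : ℝ → ℝ) (c : ℝ)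
    (θ : EuclideanSpace ℝ (Fin d)) (D : Database n d) : Matrix (Fin d) (Fin d) ℝ :=
  (1 / (n : ℝ)) • ∑ i, Matrix.of (fun j k =>
      (gradient (loss f (D i)) θ) j * (gradient (loss f (D i)) θ) k)
    - (4 * c ^ 2) • Matrix.of (fun j k => θ j * θ k)

/-- A measurable rule that selects an interval covering at least the fraction `1 - α` of `m`
given real numbers. -/
structure IsConfidenceRule {m : ℕ} (α : ℝ) (ci : (Fin m → ℝ) → ℝ × ℝ) : Prop where
  measurable : Measurable ci
  ordered : ∀ z, (ci z).1 ≤ (ci z).2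
  covers : ∀ z, (1 - α) * m ≤ (Nat.card {i : Fin m // z i ∈ Set.Icc (ci z).1 (ci z).2} : ℝ)

/-- The endpoints `(θ_L, θ_R)` of the coordinatewise confidence intervals of `m` samples. -/
def intervals {m d : ℕ} (ci : (Fin m → ℝ) → ℝ × ℝ)
    (θs : Fin m → EuclideanSpace ℝ (Fin d)) :
    EuclideanSpace ℝ (Fin d) × EuclideanSpace ℝ (Fin d) :=
  (WithLp.toLp 2 (fun j => (ci (fun i => θs i j)).1),
    WithLp.toLp 2 (fun j => (ci (fun i => θs i j)).2))

/-- The sample `θ̃ + H̃⁻¹ G / √n - β` from the approximate law of the true parameter. -/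
def paramSample {d : ℕ} (n : ℕ) (θ : EuclideanSpace ℝ (Fin d)) (H : Matrix (Fin d) (Fin d) ℝ)
    (G β : EuclideanSpace ℝ (Fin d)) : EuclideanSpace ℝ (Fin d) :=
  θ + (1 / Real.sqrt n) • WithLp.toLp 2 (H⁻¹.mulVec G) - β

/-- The law of the output `(θ_L, θ_R)` of the confidence interval algorithm for models trained
by output perturbation. The inputs `sensH θ` and `sensS θ` are the sensitivities handed to
`PrivSPDMat` for the Hessian and the covariance matrix at the released parameter `θ`. -/
def ciOutput {n d : ℕ} (mode : PrivacyMode) (f : ℝ → ℝ)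
    (hess : Record d → EuclideanSpace ℝ (Fin d) → Matrix (Fin d) (Fin d) ℝ)
    (sensH sensS : EuclideanSpace ℝ (Fin d) → ℝ≥0) (c φ₁ φ₂ φ₃ : ℝ)
    (m : ℕ) (ci : (Fin m → ℝ) → ℝ × ℝ) (D : Database n d) :
    Measure (EuclideanSpace ℝ (Fin d) × EuclideanSpace ℝ (Fin d)) :=
  (outputPerturb mode f c φ₁ D).bind fun θ =>
  (privSPDMat mode (riskHessian hess c θ D) (sensH θ) φ₂ c).bind fun H =>
  (privSPDMat mode (gradCovariance f c θ D) (sensS θ) φ₃ c).bind fun S =>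
  (Measure.pi fun _ : Fin m => multivariateGaussian 0 S).bind fun G =>
  (Measure.pi fun _ : Fin m => outputNoise mode n d c φ₁).map fun β =>
    intervals ci (fun i => paramSample n θ H (G i) (β i))

end DPCI

end

/-!
Both privacy notions are instances of one Hölder-type bound `∫ F dP ≤ K (∫ F^q dQ)^(1/q)` between
the output laws on neighbouring databases: `q = 1` is pure differential privacy, and by duality the
exponent conjugate to `a` controls the Rényi divergence of order `a`. The bound survives
post-processing and composes under adaptive steps, with budgets adding up, so the release of the
parameter, the Hessian and the covariance matrix cost `φ₁ + φ₂ + φ₃`, while the remaining steps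
never look at the data and cost nothing.

Each release adds noise to a vector. A shift by at most the sensitivity changes the spherical
Laplace density by a factor at most `exp φ` (triangle inequality), and for Gaussian noise the moment
of the density ratio is computed exactly, coordinate by coordinate. For the parameter the
sensitivity is `1 / (n c)`: the risk is `2 c`-strongly convex, and the risks of neighbouring
databases differ by a `2 / n`-Lipschitz function.
-/

noncomputable section

namespace DPCI

section HolderDomination

variable {Ω Ω' : Type*} [MeasurableSpace Ω] [MeasurableSpace Ω'] {P Q : Measure Ω}
  {K : ℝ≥0∞} {p q : ℝ}

/-- The Hölder-type bound `∫ F dP ≤ K (∫ F^q dQ)^(1/q)` for all nonnegative measurable `F`.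
For `q = 1` this is pure differential privacy with `K = exp ε`; for `q` conjugate to `p` it says
that the `p`-th moment of the density of `P` with respect to `Q` is at most `K ^ p`. -/
def HolderDominated (K : ℝ≥0∞) (q : ℝ) (P Q : Measure Ω) : Prop :=
  ∀ F : Ω → ℝ≥0∞, Measurable F → ∫⁻ ω, F ω ∂P ≤ K * (∫⁻ ω, F ω ^ q ∂Q) ^ (1 / q)

theorem HolderDominated.refl (hq : 1 ≤ q) (P : Measure Ω) [IsProbabilityMeasure P] :
    HolderDominated 1 q P P := by
  intro F hF
  have h := eLpNorm'_le_eLpNorm'_of_exponent_le (f := F) (μ := P) one_pos hq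
    hF.aestronglyMeasurable
  simpa [eLpNorm'] using h

theorem HolderDominated.mono {K' : ℝ≥0∞} (h : HolderDominated K q P Q) (hK : K ≤ K') :
    HolderDominated K' q P Q :=
  fun F hF => (h F hF).trans (by gcongr)

theorem HolderDominated.map (h : HolderDominated K q P Q) {T : Ω → Ω'} (hT : Measurable T) :
    HolderDominated K q (P.map T) (Q.map T) := by
  intro F hF
  rw [lintegral_map hF hT, lintegral_map (hF.pow_const q) hT]
  exact h _ (hF.comp hT)

theorem HolderDominated.bind {L : ℝ≥0∞} (hq : 1 ≤ q) (h : HolderDominated K q P Q)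
    {κ η : Ω → Measure Ω'} (hκ : Measurable κ) (hη : Measurable η)
    (hκη : ∀ ω, HolderDominated L q (κ ω) (η ω)) :
    HolderDominated (K * L) q (P.bind κ) (Q.bind η) := by
  intro F hF
  have hq0 : q ≠ 0 := by positivity
  have hFq : Measurable fun x => F x ^ q := hF.pow_const q
  have hm : Measurable fun ω => ∫⁻ x, F x ^ q ∂(η ω) :=
    (Measure.measurable_lintegral hFq).comp hη
  rw [Measure.lintegral_bind hκ.aemeasurable hF.aemeasurable,
    Measure.lintegral_bind hη.aemeasurable hFq.aemeasurable]
  calc ∫⁻ ω, ∫⁻ x, F x ∂(κ ω) ∂P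
      ≤ ∫⁻ ω, L * (∫⁻ x, F x ^ q ∂(η ω)) ^ (1 / q) ∂P := lintegral_mono fun ω => hκη ω F hF
    _ = L * ∫⁻ ω, (∫⁻ x, F x ^ q ∂(η ω)) ^ (1 / q) ∂P :=
        lintegral_const_mul _ (hm.pow_const _)
    _ ≤ L * (K * (∫⁻ ω, ((∫⁻ x, F x ^ q ∂(η ω)) ^ (1 / q)) ^ q ∂Q) ^ (1 / q)) := by
        gcongr
        exact h _ (hm.pow_const _)
    _ = K * L * (∫⁻ ω, ∫⁻ x, F x ^ q ∂(η ω) ∂Q) ^ (1 / q) := by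
        simp_rw [← ENNReal.rpow_mul, one_div_mul_cancel hq0, ENNReal.rpow_one]
        ring

theorem holderDominated_withDensity (hpq : p.HolderConjugate q) {g : Ω → ℝ≥0∞}
    (hg : Measurable g) :
    HolderDominated ((∫⁻ ω, g ω ^ p ∂Q) ^ (1 / p)) q (Q.withDensity g) Q := by
  intro F hF
  rw [lintegral_withDensity_eq_lintegral_mul _ hg hF]
  exact ENNReal.lintegral_mul_le_Lp_mul_Lq Q hpq hg.aemeasurable hF.aemeasurable

theorem HolderDominated.apply_le (h : HolderDominated K 1 P Q) {V : Set Ω}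
    (hV : MeasurableSet V) : P V ≤ K * Q V := by
  simpa [lintegral_indicator_one hV] using h (V.indicator 1) (measurable_one.indicator hV)

theorem HolderDominated.absolutelyContinuous (hq : 0 < q) (h : HolderDominated K q P Q) :
    P ≪ Q := by
  refine Measure.AbsolutelyContinuous.mk fun V hV hQ => ?_
  have hpow : ∀ ω, V.indicator (1 : Ω → ℝ≥0∞) ω ^ q = V.indicator 1 ω := fun ω => by
    by_cases hω : ω ∈ V <;> simp [hω, hq]
  have hle := h (V.indicator 1) (measurable_one.indicator hV)
  simp_rw [hpow] at hle
  rw [lintegral_indicator_one hV, lintegral_indicator_one hV, hQ,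
    ENNReal.zero_rpow_of_pos (by positivity), mul_zero] at hle
  exact le_antisymm hle zero_le

theorem le_rpow_of_le_mul_rpow (hpq : p.HolderConjugate q) {I : ℝ≥0∞} (hI : I ≠ ∞)
    (h : I ≤ K * I ^ (1 / q)) : I ≤ K ^ p := by
  rcases eq_or_ne I 0 with rfl | hI0
  · exact zero_le
  have hq : 0 ≤ 1 / q := one_div_nonneg.2 hpq.symm.nonneg
  have hsplit : I ^ (1 / p) * I ^ (1 / q) = I := by
    rw [← ENNReal.rpow_add _ _ hI0 hI, one_div, one_div, hpq.inv_add_inv_eq_one,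
      ENNReal.rpow_one]
  have hroot : I ^ (1 / p) ≤ K := by
    rw [← ENNReal.mul_le_mul_iff_left (c := I ^ (1 / q))
      (by simp [ENNReal.rpow_eq_zero_iff, hI0, hI]) (ENNReal.rpow_ne_top_of_nonneg hq hI), hsplit]
    exact h
  rwa [one_div, ENNReal.rpow_inv_le_iff hpq.pos] at hroot

/-- Truncation makes the moment finite, so that the test function `(min r k) ^ (p - 1)` bounds the
moment by its own `1 / q`-th power. -/
theorem HolderDominated.lintegral_min_rpow_le [IsFiniteMeasure Q] (hpq : p.HolderConjugate q)
    {r : Ω → ℝ≥0∞} (hr : Measurable r) (h : HolderDominated K q (Q.withDensity r) Q) (k : ℕ) :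
    ∫⁻ ω, min (r ω) k ^ p ∂Q ≤ K ^ p := by
  have hmin : Measurable fun ω => min (r ω) (k : ℝ≥0∞) := hr.min measurable_const
  refine le_rpow_of_le_mul_rpow hpq
    (ne_top_of_le_ne_top (b := (k : ℝ≥0∞) ^ p * Q Set.univ) ?_ ?_) ?_
  · finiteness [hpq.nonneg]
  · rw [← lintegral_const]
    exact lintegral_mono fun ω => ENNReal.rpow_le_rpow (min_le_right _ _) hpq.nonneg
  have hpow : ∀ ω, min (r ω) (k : ℝ≥0∞) ^ p ≤ r ω * min (r ω) (k : ℝ≥0∞) ^ (p - 1) := fun ω => by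
    calc min (r ω) (k : ℝ≥0∞) ^ p = min (r ω) (k : ℝ≥0∞) ^ (1 + (p - 1)) := by ring_nf
      _ = min (r ω) k * min (r ω) (k : ℝ≥0∞) ^ (p - 1) := by
          rw [ENNReal.rpow_add_of_nonneg _ _ zero_le_one hpq.sub_one_pos.le, ENNReal.rpow_one]
      _ ≤ r ω * min (r ω) (k : ℝ≥0∞) ^ (p - 1) := by gcongr; exact min_le_left _ _
  have htest := h (fun ω => min (r ω) (k : ℝ≥0∞) ^ (p - 1)) (hmin.pow_const _)
  simp_rw [← ENNReal.rpow_mul, hpq.sub_one_mul_conj] at htest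
  rw [lintegral_withDensity_eq_lintegral_mul _ hr (hmin.pow_const _)] at htest
  exact (lintegral_mono hpow).trans htest

theorem HolderDominated.lintegral_rpow_le [IsFiniteMeasure Q] (hpq : p.HolderConjugate q)
    {r : Ω → ℝ≥0∞} (hr : Measurable r) (h : HolderDominated K q (Q.withDensity r) Q) :
    ∫⁻ ω, r ω ^ p ∂Q ≤ K ^ p := by
  have hsup : ∀ ω, r ω ^ p = ⨆ k : ℕ, min (r ω) k ^ p := fun ω => by
    conv_lhs => rw [← inf_top_eq (r ω), ← ENNReal.iSup_natCast, inf_iSup_eq]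
    exact (ENNReal.orderIsoRpow p hpq.pos).map_iSup _
  simp_rw [hsup]
  rw [lintegral_iSup fun k => (hr.min measurable_const).pow_const p]
  · exact iSup_le (h.lintegral_min_rpow_le hpq hr)
  · intro i j hij ω
    exact ENNReal.rpow_le_rpow (min_le_min_left _ (by exact_mod_cast hij)) hpq.nonneg

theorem HolderDominated.renyiDiv_le {a ρ : ℝ} (ha : 1 < a) [IsFiniteMeasure P]
    [IsFiniteMeasure Q]
    (h : HolderDominated (ENNReal.ofReal (Real.exp ((a - 1) * ρ))) a.conjExponent P Q) :
    renyiDiv a P Q ≤ ((ρ * a : ℝ) : EReal) := by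
  have hpq : a.HolderConjugate a.conjExponent := .conjExponent ha
  have hac : P ≪ Q := h.absolutelyContinuous hpq.symm.pos
  have ha1 : 0 < a - 1 := hpq.sub_one_pos
  have hmoment : ∫⁻ ω, P.rnDeriv Q ω ^ a ∂Q ≤
      ENNReal.ofReal (Real.exp ((a - 1) * (ρ * a))) := by
    rw [← Measure.withDensity_rnDeriv_eq P Q hac] at h
    refine (h.lintegral_rpow_le hpq (Measure.measurable_rnDeriv P Q)).trans_eq ?_
    rw [ENNReal.ofReal_rpow_of_pos (Real.exp_pos _), ← Real.exp_mul, mul_assoc]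
  rw [renyiDiv, if_pos hac]
  calc (((a - 1)⁻¹ : ℝ) : EReal) * ENNReal.log (∫⁻ ω, P.rnDeriv Q ω ^ a ∂Q)
      ≤ (((a - 1)⁻¹ : ℝ) : EReal) * (((a - 1) * (ρ * a) : ℝ) : EReal) := by
        refine mul_le_mul_of_nonneg_left ?_ (by exact_mod_cast (inv_pos.2 ha1).le)
        refine (ENNReal.log_monotone hmoment).trans_eq ?_
        rw [ENNReal.log_ofReal_of_pos (Real.exp_pos _), Real.log_exp]
    _ = ((ρ * a : ℝ) : EReal) := by
        rw [← EReal.coe_mul, inv_mul_cancel_left₀ ha1.ne']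

end HolderDomination

section Indistinguishability

variable {Ω Ω' : Type*} [MeasurableSpace Ω] [MeasurableSpace Ω'] {P Q : Measure Ω}
  {mode : PrivacyMode} {φ ψ : ℝ}

/-- The privacy loss between two output laws is at most `φ`, as measured by the given privacy
notion. Both notions are expressed by Hölder domination, so that they compose by the same
argument: pure differential privacy is the exponent `q = 1`, and zCDP is the whole family of
conjugate exponents, `p` being the order of the Rényi divergence. -/
def Indistinguishable (mode : PrivacyMode) (φ : ℝ) (P Q : Measure Ω) : Prop :=
  match mode with
  | .pureDP => HolderDominated (ENNReal.ofReal (Real.exp φ)) 1 P Q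
  | .zCDP => ∀ p q : ℝ, p.HolderConjugate q →
      HolderDominated (ENNReal.ofReal (Real.exp ((p - 1) * φ))) q P Q

theorem Indistinguishable.refl (mode : PrivacyMode) (hφ : 0 ≤ φ) (P : Measure Ω)
    [IsProbabilityMeasure P] : Indistinguishable mode φ P P := by
  cases mode with
  | pureDP =>
    refine (HolderDominated.refl le_rfl P).mono ?_
    rw [ENNReal.one_le_ofReal]
    exact Real.one_le_exp hφ
  | zCDP =>
    intro p q hpq
    refine (HolderDominated.refl hpq.symm.lt.le P).mono ?_
    rw [ENNReal.one_le_ofReal]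
    exact Real.one_le_exp (mul_nonneg hpq.sub_one_pos.le hφ)

theorem Indistinguishable.map (h : Indistinguishable mode φ P Q) {T : Ω → Ω'}
    (hT : Measurable T) : Indistinguishable mode φ (P.map T) (Q.map T) := by
  cases mode with
  | pureDP => exact HolderDominated.map h hT
  | zCDP => exact fun p q hpq => (h p q hpq).map hT

theorem Indistinguishable.bind (h : Indistinguishable mode φ P Q) {κ η : Ω → Measure Ω'}
    (hκ : Measurable κ) (hη : Measurable η)
    (hκη : ∀ ω, Indistinguishable mode ψ (κ ω) (η ω)) :
    Indistinguishable mode (φ + ψ) (P.bind κ) (Q.bind η) := by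
  have hexp : ∀ x y : ℝ, ENNReal.ofReal (Real.exp x) * ENNReal.ofReal (Real.exp y) =
      ENNReal.ofReal (Real.exp (x + y)) := fun x y => by
    rw [← ENNReal.ofReal_mul (Real.exp_pos x).le, ← Real.exp_add]
  cases mode with
  | pureDP => exact (HolderDominated.bind le_rfl h hκ hη hκη).mono (hexp φ ψ).le
  | zCDP =>
    intro p q hpq
    refine ((h p q hpq).bind hpq.symm.lt.le hκ hη fun ω => hκη ω p q hpq).mono ?_
    rw [hexp, mul_add]

end Indistinguishability

section ParametrizedMeasures

variable {Ω Ω' Ω'' : Type*} [MeasurableSpace Ω] [MeasurableSpace Ω'] [MeasurableSpace Ω'']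

theorem measurable_measure_map {κ : Ω → Measure Ω'} (hκ : Measurable κ)
    [hP : ∀ ω, IsProbabilityMeasure (κ ω)] {g : Ω → Ω' → Ω''}
    (hg : Measurable (Function.uncurry g)) : Measurable fun ω => (κ ω).map (g ω) := by
  let k : Kernel Ω Ω' := ⟨κ, hκ⟩
  have : IsMarkovKernel k := ⟨hP⟩
  refine Measure.measurable_of_measurable_coe _ fun V hV => ?_
  have h : ∀ ω, (κ ω).map (g ω) V = k ω (Prod.mk ω ⁻¹' (Function.uncurry g ⁻¹' V)) := fun ω =>
    Measure.map_apply (hg.comp measurable_prodMk_left) hV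
  simp_rw [h]
  exact Kernel.measurable_kernel_prodMk_left (hg hV)

theorem measurable_measure_bind {κ : Ω → Measure Ω'} (hκ : Measurable κ)
    [hP : ∀ ω, IsProbabilityMeasure (κ ω)] {g : Ω × Ω' → Measure Ω''} (hg : Measurable g) :
    Measurable fun ω => (κ ω).bind fun x => g (ω, x) := by
  let k : Kernel Ω Ω' := ⟨κ, hκ⟩
  have : IsMarkovKernel k := ⟨hP⟩
  refine Measure.measurable_of_measurable_coe _ fun V hV => ?_
  have h : ∀ ω, (κ ω).bind (fun x => g (ω, x)) V = ∫⁻ x, g (ω, x) V ∂(k ω) := fun ω =>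
    Measure.bind_apply hV (hg.comp measurable_prodMk_left).aemeasurable
  simp_rw [h]
  exact Measurable.lintegral_kernel_prod_right ((Measure.measurable_coe hV).comp hg)

theorem measurable_measure_pi {ι : Type*} [Fintype ι] {κ : ι → Ω → Measure Ω'}
    (hκ : ∀ i, Measurable (κ i)) [∀ i ω, IsProbabilityMeasure (κ i ω)] :
    Measurable fun ω => Measure.pi fun i => κ i ω := by
  refine Measurable.measure_of_isPiSystem_of_isProbabilityMeasure generateFrom_pi.symm
    isPiSystem_pi ?_
  rintro _ ⟨s, hs, rfl⟩
  simp_rw [Measure.pi_pi]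
  exact Finset.measurable_prod _ fun i _ =>
    (Measure.measurable_coe (hs i (Set.mem_univ i))).comp (hκ i)

theorem isProbabilityMeasure_bind {P : Measure Ω} [IsProbabilityMeasure P] {κ : Ω → Measure Ω'}
    (hκ : Measurable κ) [∀ ω, IsProbabilityMeasure (κ ω)] :
    IsProbabilityMeasure (P.bind κ) :=
  ⟨by simp [Measure.bind_apply MeasurableSet.univ hκ.aemeasurable]⟩

end ParametrizedMeasures

section AdaptivePrivacy

variable {n d : ℕ} {Ω Ω' Ω'' : Type*} [MeasurableSpace Ω] [MeasurableSpace Ω']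
  [MeasurableSpace Ω''] {mode : PrivacyMode} {φ ψ : ℝ} {M : Database n d → Ω → Measure Ω'}

/-- A randomized mechanism that also reads the value `ω` of earlier, already released outputs and
is private with budget `φ` for every such value. A mechanism without earlier outputs is encoded by
`Ω = Unit`. -/
structure IsAdaptivelyPrivate (mode : PrivacyMode) (φ : ℝ) (M : Database n d → Ω → Measure Ω') :
    Prop where
  measurable : ∀ D, Measurable (M D)
  isProbabilityMeasure : ∀ D ω, IsProbabilityMeasure (M D ω)
  indistinguishable : ∀ D D', Neighbor D D' → ∀ ω, Indistinguishable mode φ (M D ω) (M D' ω)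

theorem isAdaptivelyPrivate_const {κ : Ω → Measure Ω'} (hκ : Measurable κ)
    [∀ ω, IsProbabilityMeasure (κ ω)] :
    IsAdaptivelyPrivate mode 0 fun _ : Database n d => κ where
  measurable _ := hκ
  isProbabilityMeasure _ := inferInstance
  indistinguishable _ _ _ ω := .refl mode le_rfl (κ ω)

theorem IsAdaptivelyPrivate.comp (h : IsAdaptivelyPrivate mode φ M) {g : Ω'' → Ω}
    (hg : Measurable g) : IsAdaptivelyPrivate mode φ fun D ω => M D (g ω) where
  measurable D := (h.measurable D).comp hg
  isProbabilityMeasure D ω := h.isProbabilityMeasure D (g ω)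
  indistinguishable D D' hD ω := h.indistinguishable D D' hD (g ω)

theorem IsAdaptivelyPrivate.map (h : IsAdaptivelyPrivate mode φ M) {T : Ω → Ω' → Ω''}
    (hT : Measurable (Function.uncurry T)) :
    IsAdaptivelyPrivate mode φ fun D ω => (M D ω).map (T ω) where
  measurable D :=
    have := h.isProbabilityMeasure D
    measurable_measure_map (h.measurable D) hT
  isProbabilityMeasure D ω :=
    have := h.isProbabilityMeasure D ω
    Measure.isProbabilityMeasure_map (hT.comp measurable_prodMk_left).aemeasurable
  indistinguishable D D' hD ω :=
    (h.indistinguishable D D' hD ω).map (hT.comp measurable_prodMk_left)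

theorem IsAdaptivelyPrivate.bind (hM : IsAdaptivelyPrivate mode φ M)
    {N : Database n d → Ω × Ω' → Measure Ω''} (hN : IsAdaptivelyPrivate mode ψ N) :
    IsAdaptivelyPrivate mode (φ + ψ) fun D ω => (M D ω).bind fun x => N D (ω, x) where
  measurable D :=
    have := hM.isProbabilityMeasure D
    measurable_measure_bind (hM.measurable D) (hN.measurable D)
  isProbabilityMeasure D ω :=
    have := hM.isProbabilityMeasure D ω
    have := fun x => hN.isProbabilityMeasure D (ω, x)
    isProbabilityMeasure_bind ((hN.measurable D).comp measurable_prodMk_left)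
  indistinguishable D D' hD ω :=
    (hM.indistinguishable D D' hD ω).bind ((hN.measurable D).comp measurable_prodMk_left)
      ((hN.measurable D').comp measurable_prodMk_left)
      fun x => hN.indistinguishable D D' hD (ω, x)

theorem IsAdaptivelyPrivate.isDifferentiallyPrivate (h : IsAdaptivelyPrivate .pureDP φ M)
    (ω : Ω) : IsDifferentiallyPrivate φ fun D => M D ω where
  isProbabilityMeasure D := h.isProbabilityMeasure D ω
  le D D' hD _ hV := HolderDominated.apply_le (h.indistinguishable D D' hD ω) hV

theorem IsAdaptivelyPrivate.isZCDP (h : IsAdaptivelyPrivate .zCDP φ M) (ω : Ω) :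
    IsZCDP φ fun D => M D ω where
  isProbabilityMeasure D := h.isProbabilityMeasure D ω
  le D D' hD a ha :=
    have := h.isProbabilityMeasure D ω
    have := h.isProbabilityMeasure D' ω
    HolderDominated.renyiDiv_le ha (h.indistinguishable D D' hD ω a _ (.conjExponent ha))

end AdaptivePrivacy

section ProductDensities

variable {ι : Type*} [Fintype ι] {Ω : ι → Type*} {g : ∀ i, Ω i → ℝ≥0∞}

theorem indicator_univ_pi_prod (s : ∀ i, Set (Ω i)) (x : ∀ i, Ω i) :
    (Set.univ.pi s).indicator (fun x => ∏ i, g i (x i)) x =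
      ∏ i, (s i).indicator (g i) (x i) := by
  by_cases hx : x ∈ Set.univ.pi s
  · rw [Set.indicator_of_mem hx]
    exact Finset.prod_congr rfl fun i _ =>
      (Set.indicator_of_mem (hx i (Set.mem_univ i)) _).symm
  · obtain ⟨i, hi⟩ : ∃ i, x i ∉ s i := by simpa using hx
    rw [Set.indicator_of_notMem hx]
    exact (Finset.prod_eq_zero (Finset.mem_univ i) (Set.indicator_of_notMem hi _)).symm

variable [∀ i, MeasurableSpace (Ω i)] (μ : ∀ i, Measure (Ω i)) [∀ i, IsProbabilityMeasure (μ i)]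

theorem lintegral_pi_prod (hg : ∀ i, Measurable (g i)) :
    ∫⁻ x, ∏ i, g i (x i) ∂(Measure.pi μ) = ∏ i, ∫⁻ x, g i x ∂(μ i) := by
  refine (lintegral_prod_eq_prod_lintegral_of_indepFun Finset.univ
    (fun i (x : ∀ i, Ω i) => g i (x i)) (iIndepFun_pi fun i => (hg i).aemeasurable)
    (fun i => (hg i).comp (measurable_pi_apply i))).trans ?_
  exact Finset.prod_congr rfl fun i _ => (measurePreserving_eval μ i).lintegral_comp (hg i)

theorem pi_withDensity (hg : ∀ i, Measurable (g i))
    [∀ i, SigmaFinite ((μ i).withDensity (g i))] :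
    Measure.pi (fun i => (μ i).withDensity (g i)) =
      (Measure.pi μ).withDensity (fun x => ∏ i, g i (x i)) := by
  refine Measure.pi_eq fun s hs => ?_
  have hpi : MeasurableSet (Set.univ.pi s) := MeasurableSet.univ_pi hs
  simp_rw [withDensity_apply _ hpi, withDensity_apply _ (hs _), ← lintegral_indicator hpi,
    ← lintegral_indicator (hs _), indicator_univ_pi_prod]
  exact lintegral_pi_prod μ fun i => (hg i).indicator (hs i)

end ProductDensities

section SphericalLaplace

variable {ι : Type*} [Fintype ι] {γ : ℝ}

theorem integrable_exp_neg_mul_norm {E : Type*} [NormedAddCommGroup E] [NormedSpace ℝ E]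
    [FiniteDimensional ℝ E] [MeasurableSpace E] [BorelSpace E] (μ : Measure E)
    [μ.IsAddHaarMeasure] (hγ : 0 < γ) :
    Integrable (fun β : E => Real.exp (-γ * ‖β‖)) μ := by
  set N := Module.finrank ℝ E + 1 with hN
  have hpoly : Integrable
      (fun β : E => N.factorial / γ ^ N * Real.exp γ * (1 + ‖β‖) ^ (-(N : ℝ))) μ :=
    (integrable_one_add_norm (by simp [hN])).const_mul _
  refine hpoly.mono' (by fun_prop) (.of_forall fun β => ?_)
  have hpow : (1 + ‖β‖) ^ N ≤ N.factorial / γ ^ N * Real.exp (γ * (1 + ‖β‖)) := by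
    have h := Real.pow_div_factorial_le_exp (x := γ * (1 + ‖β‖)) (by positivity) N
    rw [mul_pow, div_le_iff₀ (by positivity)] at h
    rw [div_mul_eq_mul_div, le_div_iff₀ (by positivity)]
    linarith
  rw [Real.norm_of_nonneg (Real.exp_pos _).le, Real.rpow_neg (by positivity), Real.rpow_natCast,
    ← div_eq_mul_inv, le_div_iff₀ (by positivity)]
  calc Real.exp (-γ * ‖β‖) * (1 + ‖β‖) ^ N
      ≤ Real.exp (-γ * ‖β‖) * (N.factorial / γ ^ N * Real.exp (γ * (1 + ‖β‖))) := by gcongr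
    _ = N.factorial / γ ^ N * (Real.exp (-γ * ‖β‖) * Real.exp (γ * (1 + ‖β‖))) := by ring
    _ = N.factorial / γ ^ N * Real.exp γ := by
        rw [← Real.exp_add]
        ring_nf

theorem isProbabilityMeasure_sphericalLaplace (hγ : 0 < γ) :
    IsProbabilityMeasure (sphericalLaplace ι γ) := by
  have hint := integrable_exp_neg_mul_norm (volume : Measure (EuclideanSpace ℝ ι)) hγ
  have hmass := ofReal_integral_eq_lintegral_ofReal hint (.of_forall fun β => (Real.exp_pos _).le)
  refine ⟨?_⟩
  rw [sphericalLaplace, Measure.smul_apply, withDensity_apply _ MeasurableSet.univ,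
    Measure.restrict_univ, smul_eq_mul, ← hmass]
  exact ENNReal.inv_mul_cancel (ENNReal.ofReal_pos.2 (integral_exp_pos hint)).ne'
    ENNReal.ofReal_ne_top

theorem measurable_sphericalLaplace : Measurable (sphericalLaplace ι) := by
  have hdensity : Measurable fun p : ℝ × EuclideanSpace ℝ ι =>
      ENNReal.ofReal (Real.exp (-p.1 * ‖p.2‖)) := by fun_prop
  refine Measure.measurable_of_measurable_coe _ fun V hV => ?_
  simp_rw [sphericalLaplace, Measure.smul_apply, withDensity_apply _ hV, smul_eq_mul]
  exact hdensity.lintegral_prod_right.inv.mul hdensity.lintegral_prod_right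

theorem lintegral_map_const_add_sphericalLaplace (γ : ℝ) (u : EuclideanSpace ℝ ι)
    {F : EuclideanSpace ℝ ι → ℝ≥0∞} (hF : Measurable F) :
    ∫⁻ x, F x ∂((sphericalLaplace ι γ).map (u + ·)) =
      (∫⁻ β : EuclideanSpace ℝ ι, ENNReal.ofReal (Real.exp (-γ * ‖β‖)))⁻¹ *
        ∫⁻ x, ENNReal.ofReal (Real.exp (-γ * dist x u)) * F x := by
  rw [lintegral_map hF (by fun_prop), sphericalLaplace, lintegral_smul_measure,
    lintegral_withDensity_eq_lintegral_mul _ (by fun_prop) (by fun_prop), smul_eq_mul,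
    ← lintegral_add_left_eq_self (fun x => ENNReal.ofReal (Real.exp (-γ * dist x u)) * F x) u]
  simp [dist_eq_norm]

theorem sphericalLaplace_shift_holderDominated (hγ : 0 ≤ γ) (u w : EuclideanSpace ℝ ι) :
    HolderDominated (ENNReal.ofReal (Real.exp (γ * dist u w))) 1
      ((sphericalLaplace ι γ).map (u + ·)) ((sphericalLaplace ι γ).map (w + ·)) := by
  intro F hF
  have hdensity : ∀ x, ENNReal.ofReal (Real.exp (-γ * dist x u)) * F x ≤
      ENNReal.ofReal (Real.exp (γ * dist u w)) *
        (ENNReal.ofReal (Real.exp (-γ * dist x w)) * F x) := fun x => by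
    rw [← mul_assoc, ← ENNReal.ofReal_mul (Real.exp_pos _).le, ← Real.exp_add]
    gcongr
    linarith [mul_le_mul_of_nonneg_left (dist_triangle x u w) hγ]
  simp only [ENNReal.rpow_one, div_one]
  rw [lintegral_map_const_add_sphericalLaplace γ u hF,
    lintegral_map_const_add_sphericalLaplace γ w hF, mul_left_comm,
    ← lintegral_const_mul (ENNReal.ofReal (Real.exp (γ * dist u w))) (by fun_prop)]
  exact mul_le_mul_right (lintegral_mono hdensity) _

end SphericalLaplace

section IsotropicGaussian

variable {ι : Type*} [Fintype ι] {v : ℝ≥0} {p q : ℝ}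

instance isProbabilityMeasure_isotropicGaussian (v : ℝ≥0) :
    IsProbabilityMeasure (isotropicGaussian ι v) :=
  Measure.isProbabilityMeasure_map (by fun_prop)

theorem measurable_isotropicGaussian : Measurable (isotropicGaussian ι) := by
  refine (Measure.measurable_map _ (WithLp.measurable_toLp 2 _)).comp
    (measurable_measure_pi fun _ => ?_)
  exact measurable_gaussianReal.comp measurable_prodMk_left

theorem isotropicGaussian_map_const_add (v : ℝ≥0) (w : EuclideanSpace ℝ ι) :
    (isotropicGaussian ι v).map (w + ·) =
      (Measure.pi fun i => gaussianReal (w i) v).map (WithLp.toLp 2) := by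
  have hshift : (Measure.pi fun i => gaussianReal (w i) v) =
      (Measure.pi fun _ : ι => gaussianReal 0 v).map fun x i => w i + x i := by
    rw [Measure.pi_map_pi (f := fun i x => w i + x) fun i => by fun_prop]
    simp_rw [gaussianReal_map_const_add, zero_add]
  rw [hshift, isotropicGaussian, Measure.map_map (by fun_prop) (by fun_prop),
    Measure.map_map (by fun_prop) (by fun_prop)]
  rfl

/-- The density of `N(w, v)` with respect to `N(0, v)`. -/
def gaussianTilt (v : ℝ≥0) (w x : ℝ) : ℝ≥0∞ :=
  ENNReal.ofReal (Real.exp ((2 * x * w - w ^ 2) / (2 * v)))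

theorem measurable_gaussianTilt (v : ℝ≥0) (w : ℝ) : Measurable (gaussianTilt v w) := by
  unfold gaussianTilt
  fun_prop

theorem gaussianReal_withDensity_gaussianTilt (hv : v ≠ 0) (w : ℝ) :
    (gaussianReal 0 v).withDensity (gaussianTilt v w) = gaussianReal w v := by
  rw [gaussianReal_of_var_ne_zero _ hv, gaussianReal_of_var_ne_zero _ hv,
    ← withDensity_mul _ (measurable_gaussianPDF 0 v) (measurable_gaussianTilt v w)]
  congr 1
  ext x
  rw [Pi.mul_apply, gaussianPDF, gaussianPDF, gaussianTilt,
    ← ENNReal.ofReal_mul (gaussianPDFReal_nonneg _ _ _), gaussianPDFReal, gaussianPDFReal,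
    mul_assoc, ← Real.exp_add]
  congr 3
  ring

theorem lintegral_gaussianTilt_rpow (hv : v ≠ 0) (w p : ℝ) :
    ∫⁻ x, gaussianTilt v w x ^ p ∂(gaussianReal 0 v) =
      ENNReal.ofReal (Real.exp (p * ((p - 1) / (2 * v) * w ^ 2))) := by
  have hv' : (v : ℝ) ≠ 0 := by exact_mod_cast hv
  have hsplit : ∀ x, gaussianTilt v w x ^ p =
      ENNReal.ofReal (Real.exp (-(p * w ^ 2 / (2 * v)))) *
        ENNReal.ofReal (Real.exp (p * w / v * x)) := fun x => by
    rw [gaussianTilt, ENNReal.ofReal_rpow_of_pos (Real.exp_pos _), ← Real.exp_mul,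
      ← ENNReal.ofReal_mul (Real.exp_pos _).le, ← Real.exp_add]
    congr 2
    field_simp
    ring
  have hmgf := congrFun (mgf_fun_id_gaussianReal (μ := 0) (v := v)) (p * w / v)
  rw [mgf] at hmgf
  simp_rw [hsplit]
  rw [lintegral_const_mul _ (by fun_prop), ← ofReal_integral_eq_lintegral_ofReal
    (integrable_exp_mul_gaussianReal _) (.of_forall fun x => (Real.exp_pos _).le),
    ← ENNReal.ofReal_mul (Real.exp_pos _).le, hmgf, ← Real.exp_add]
  congr 2
  field_simp
  ring

theorem pi_gaussianReal_holderDominated (hpq : p.HolderConjugate q) (hv : v ≠ 0) (w : ι → ℝ) :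
    HolderDominated (ENNReal.ofReal (Real.exp ((p - 1) / (2 * v) * ∑ i, w i ^ 2))) q
      (Measure.pi fun i => gaussianReal (w i) v) (Measure.pi fun _ => gaussianReal 0 v) := by
  have hdensity : (Measure.pi fun _ : ι => gaussianReal 0 v).withDensity
      (fun x => ∏ i, gaussianTilt v (w i) (x i)) = Measure.pi fun i => gaussianReal (w i) v := by
    have : ∀ i, IsProbabilityMeasure ((gaussianReal 0 v).withDensity (gaussianTilt v (w i))) :=
      fun i => by
        rw [gaussianReal_withDensity_gaussianTilt hv]
        infer_instance
    rw [← pi_withDensity _ fun i => measurable_gaussianTilt v (w i)]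
    simp_rw [gaussianReal_withDensity_gaussianTilt hv]
  have hmoment :
      ∫⁻ x, (∏ i, gaussianTilt v (w i) (x i)) ^ p ∂(Measure.pi fun _ => gaussianReal 0 v) =
        ENNReal.ofReal (Real.exp ((p - 1) / (2 * v) * ∑ i, w i ^ 2)) ^ p := by
    simp_rw [← ENNReal.prod_rpow_of_nonneg hpq.nonneg]
    rw [lintegral_pi_prod _ fun i => (measurable_gaussianTilt v (w i)).pow_const p]
    simp_rw [lintegral_gaussianTilt_rpow hv]
    rw [← ENNReal.ofReal_prod_of_nonneg fun i _ => (Real.exp_pos _).le, ← Real.exp_sum,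
      ENNReal.ofReal_rpow_of_pos (Real.exp_pos _), ← Real.exp_mul, Finset.mul_sum, Finset.sum_mul]
    simp_rw [mul_comm p]
  have h := holderDominated_withDensity (Q := Measure.pi fun _ : ι => gaussianReal 0 v) hpq
    (Finset.measurable_prod Finset.univ fun i _ =>
      (measurable_gaussianTilt v (w i)).comp (measurable_pi_apply i))
  simp only [Function.comp_apply] at h
  rwa [hdensity, hmoment, ← ENNReal.rpow_mul, mul_one_div_cancel hpq.ne_zero,
    ENNReal.rpow_one] at h

theorem isotropicGaussian_shift_holderDominated (hpq : p.HolderConjugate q) (hv : v ≠ 0)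
    (u w : EuclideanSpace ℝ ι) :
    HolderDominated (ENNReal.ofReal (Real.exp ((p - 1) / (2 * v) * dist u w ^ 2))) q
      ((isotropicGaussian ι v).map (u + ·)) ((isotropicGaussian ι v).map (w + ·)) := by
  have hzero : HolderDominated (ENNReal.ofReal (Real.exp ((p - 1) / (2 * v) * dist u w ^ 2))) q
      ((isotropicGaussian ι v).map (u - w + ·)) (isotropicGaussian ι v) := by
    rw [isotropicGaussian_map_const_add, dist_eq_norm, EuclideanSpace.real_norm_sq_eq]
    exact (pi_gaussianReal_holderDominated hpq hv _).map (WithLp.measurable_toLp 2 _)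
  have hmap : (isotropicGaussian ι v).map (u + ·) =
      ((isotropicGaussian ι v).map (u - w + ·)).map (w + ·) := by
    rw [Measure.map_map (by fun_prop) (by fun_prop)]
    congr 1
    ext1 x
    simp only [Function.comp_apply]
    abel
  rw [hmap]
  exact hzero.map (by fun_prop)

end IsotropicGaussian

section PrivacyNoise

variable {ι : Type*} [Fintype ι] {mode : PrivacyMode} {φ : ℝ}

theorem isProbabilityMeasure_privacyNoise (mode : PrivacyMode) (s : ℝ≥0) (hφ : 0 < φ) :
    IsProbabilityMeasure (privacyNoise mode ι s φ) := by
  cases mode with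
  | pureDP =>
    rcases eq_or_ne s 0 with hs | hs
    · simp only [privacyNoise, hs, if_true]
      infer_instance
    · simp only [privacyNoise, hs, if_false]
      exact isProbabilityMeasure_sphericalLaplace (by positivity)
  | zCDP => exact isProbabilityMeasure_isotropicGaussian _

theorem measurable_privacyNoise (mode : PrivacyMode) (φ : ℝ) :
    Measurable fun s => privacyNoise mode ι s φ := by
  cases mode with
  | pureDP =>
    refine Measurable.ite (measurableSet_singleton (0 : ℝ≥0)) measurable_const ?_
    exact measurable_sphericalLaplace.comp (by fun_prop)
  | zCDP => exact measurable_isotropicGaussian.comp (by fun_prop)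

theorem privacyNoise_shift_indistinguishable (hφ : 0 < φ) {s : ℝ≥0} {u w : EuclideanSpace ℝ ι}
    (huw : dist u w ≤ s) :
    Indistinguishable mode φ
      ((privacyNoise mode ι s φ).map (u + ·)) ((privacyNoise mode ι s φ).map (w + ·)) := by
  rcases eq_or_ne s 0 with rfl | hs
  · have := isProbabilityMeasure_privacyNoise (ι := ι) mode 0 hφ
    obtain rfl : u = w := dist_le_zero.1 huw
    have := Measure.isProbabilityMeasure_map (μ := privacyNoise mode ι 0 φ) (f := (u + ·))
      (by fun_prop)
    exact .refl mode hφ.le _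
  have hs' : 0 < (s : ℝ) := by positivity
  cases mode with
  | pureDP =>
    simp only [privacyNoise, hs, if_false]
    refine (sphericalLaplace_shift_holderDominated (by positivity) u w).mono ?_
    gcongr
    rw [div_mul_eq_mul_div, div_le_iff₀ hs']
    gcongr
  | zCDP =>
    intro p q hpq
    have hv : 0 < (s : ℝ) ^ 2 / (2 * φ) := by positivity
    have hp : 0 < p - 1 := hpq.sub_one_pos
    refine (isotropicGaussian_shift_holderDominated hpq (by simpa using hv) u w).mono ?_
    rw [Real.coe_toNNReal _ hv.le]
    refine ENNReal.ofReal_le_ofReal (Real.exp_le_exp.2 ?_)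
    calc (p - 1) / (2 * ((s : ℝ) ^ 2 / (2 * φ))) * dist u w ^ 2
        ≤ (p - 1) / (2 * ((s : ℝ) ^ 2 / (2 * φ))) * (s : ℝ) ^ 2 := by gcongr
      _ = (p - 1) * φ := by field_simp

variable {n d : ℕ} {Ω : Type*} [MeasurableSpace Ω]

theorem edist_le_l2Sensitivity (g : Database n d → EuclideanSpace ℝ ι) {D D' : Database n d}
    (hD : Neighbor D D') : edist (g D) (g D') ≤ l2Sensitivity g :=
  le_iSup₂_of_le D D' (le_iSup_of_le hD le_rfl)

theorem privacyNoise_isAdaptivelyPrivate (mode : PrivacyMode) (hφ : 0 < φ)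
    {g : Database n d → Ω → EuclideanSpace ℝ ι} (hg : ∀ D, Measurable (g D))
    {s : Ω → ℝ≥0} (hs : Measurable s) (hgs : ∀ ω, l2Sensitivity (fun D => g D ω) ≤ s ω) :
    IsAdaptivelyPrivate mode φ fun D ω => (privacyNoise mode ι (s ω) φ).map (g D ω + ·) where
  measurable D :=
    have := fun ω => isProbabilityMeasure_privacyNoise (ι := ι) mode (s ω) hφ
    measurable_measure_map (κ := fun ω => privacyNoise mode ι (s ω) φ)
      ((measurable_privacyNoise mode φ).comp hs)
      (g := fun ω β => g D ω + β) (((hg D).comp measurable_fst).add measurable_snd)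
  isProbabilityMeasure D ω :=
    have := isProbabilityMeasure_privacyNoise (ι := ι) mode (s ω) hφ
    Measure.isProbabilityMeasure_map (by fun_prop)
  indistinguishable D D' hD ω := by
    refine privacyNoise_shift_indistinguishable hφ ?_
    have h := (edist_le_l2Sensitivity (fun D => g D ω) hD).trans (hgs ω)
    rw [edist_nndist] at h
    exact_mod_cast h

end PrivacyNoise

section Matrices

open scoped MatrixOrder

variable {d : ℕ}

instance borelSpace_matrix : BorelSpace (Matrix (Fin d) (Fin d) ℝ) :=
  inferInstanceAs (BorelSpace (Fin d → Fin d → ℝ))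

theorem isClosed_setOf_nonneg_matrix : IsClosed {S : Matrix (Fin d) (Fin d) ℝ | 0 ≤ S} := by
  simp_rw [Matrix.nonneg_iff_posSemidef, Matrix.posSemidef_iff_dotProduct_mulVec, Set.ofPred_and,
    Set.ofPred_forall]
  exact (isClosed_eq (by fun_prop) continuous_id).inter
    (isClosed_iInter fun x => isClosed_le continuous_const (by fun_prop))

section L2OperatorNorm

-- The isometric functional calculus is available for the operator norm, whose topology is the
-- entrywise one.
open scoped Matrix.Norms.L2Operator

theorem clipSPD_eq_cfc (c : ℝ) (M : Matrix (Fin d) (Fin d) ℝ) :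
    clipSPD c M = cfc (max · (2 * c)) (symmPart M) := by
  rw [(symmPart_isHermitian M).cfc_eq, Matrix.IsHermitian.cfc, Unitary.conjStarAlgAut_apply]
  rfl

theorem continuous_clipSPD (c : ℝ) : Continuous (clipSPD (d := d) c) := by
  have hsymm : Continuous (symmPart (d := d)) := by
    unfold symmPart
    fun_prop
  simp_rw [funext (clipSPD_eq_cfc c)]
  exact hsymm.cfc_of_mem_nhdsSet (s := Set.univ) _ Filter.univ_mem
    (ha' := symmPart_isHermitian) (hf := by fun_prop)

theorem measurable_matrix_sqrt : Measurable (CFC.sqrt : Matrix (Fin d) (Fin d) ℝ → _) := by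
  classical
  have hpiecewise : (CFC.sqrt : Matrix (Fin d) (Fin d) ℝ → _) =
      {S | 0 ≤ S}.piecewise CFC.sqrt 0 := by
    ext1 S
    by_cases hS : 0 ≤ S
    · exact (if_pos hS).symm
    · exact (CFC.sqrt_of_not_nonneg hS).trans (if_neg hS).symm
  rw [hpiecewise]
  exact CFC.continuousOn_sqrt.measurable_piecewise continuousOn_const
    isClosed_setOf_nonneg_matrix.measurableSet

end L2OperatorNorm

theorem measurable_matrix_apply (i j : Fin d) :
    Measurable fun M : Matrix (Fin d) (Fin d) ℝ => M i j :=
  (measurable_pi_apply j).comp (measurable_pi_apply i)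

theorem measurable_matrix_iff {Ω : Type*} [MeasurableSpace Ω] {g : Ω → Matrix (Fin d) (Fin d) ℝ} :
    Measurable g ↔ ∀ i j, Measurable fun ω => g ω i j :=
  measurable_pi_iff.trans (forall_congr' fun _ => measurable_pi_iff)

theorem measurable_mulVec_toLp : Measurable fun p : Matrix (Fin d) (Fin d) ℝ ×
    EuclideanSpace ℝ (Fin d) => (WithLp.toLp 2 (p.1.mulVec p.2) : EuclideanSpace ℝ (Fin d)) :=
  Continuous.measurable (by fun_prop)

theorem measurable_matrix_inv : Measurable fun M : Matrix (Fin d) (Fin d) ℝ => M⁻¹ := by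
  have hdet : Measurable fun M : Matrix (Fin d) (Fin d) ℝ => M.det⁻¹ :=
    (Continuous.measurable (by fun_prop)).inv
  have hadjugate : Measurable fun M : Matrix (Fin d) (Fin d) ℝ => M.adjugate :=
    Continuous.measurable (by fun_prop)
  simp_rw [Matrix.inv_def, Ring.inverse_eq_inv']
  exact measurable_matrix_iff.2 fun i j =>
    hdet.mul ((measurable_matrix_apply i j).comp hadjugate)

theorem measurable_multivariateGaussian (μ : EuclideanSpace ℝ (Fin d)) :
    Measurable (multivariateGaussian μ) := by
  refine measurable_measure_map measurable_const (measurable_const.add ?_)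
  exact measurable_mulVec_toLp.comp
    ((measurable_matrix_sqrt.comp measurable_fst).prodMk measurable_snd)

theorem measurable_toMat : Measurable (toMat (d := d)) :=
  measurable_matrix_iff.2 fun i j => by
    simp only [toMat, Matrix.of_apply]
    fun_prop

theorem measurable_toVec : Measurable (toVec (d := d)) :=
  (WithLp.measurable_toLp 2 _).comp
    (measurable_pi_lambda _ fun p => measurable_matrix_apply p.1 p.2)

theorem measurable_clipSPD_toMat (c : ℝ) : Measurable fun η => clipSPD (d := d) c (toMat η) :=
  (continuous_clipSPD c).measurable.comp measurable_toMat

theorem privSPDMat_eq_map (mode : PrivacyMode) (M : Matrix (Fin d) (Fin d) ℝ) (s : ℝ≥0)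
    (φ c : ℝ) : privSPDMat mode M s φ c =
      ((privacyNoise mode (Fin d × Fin d) s φ).map (toVec M + ·)).map
        fun η => clipSPD c (toMat η) := by
  rw [Measure.map_map (measurable_clipSPD_toMat c) (by fun_prop)]
  rfl

theorem privSPDMat_isAdaptivelyPrivate {n : ℕ} {Ω : Type*} [MeasurableSpace Ω]
    (mode : PrivacyMode) {φ : ℝ} (hφ : 0 < φ) (c : ℝ)
    {M : Database n d → Ω → Matrix (Fin d) (Fin d) ℝ} (hM : ∀ D, Measurable (M D))
    {s : Ω → ℝ≥0} (hs : Measurable s)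
    (hMs : ∀ ω, l2Sensitivity (fun D => toVec (M D ω)) ≤ s ω) :
    IsAdaptivelyPrivate mode φ fun D ω => privSPDMat mode (M D ω) (s ω) φ c := by
  simp_rw [privSPDMat_eq_map]
  exact (privacyNoise_isAdaptivelyPrivate mode hφ (fun D => measurable_toVec.comp (hM D))
    hs hMs).map ((measurable_clipSPD_toMat c).comp measurable_snd)

end Matrices

section StrongConvexity

variable {E : Type*} [NormedAddCommGroup E] {s : Set E} {F G : E → ℝ} {μ : ℝ} {K : ℝ≥0}

theorem quadratic_growth_of_isMinOn [NormedSpace ℝ E] (hF : StrongConvexOn s μ F) {x y : E}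
    (hx : x ∈ s) (hy : y ∈ s) (hmin : IsMinOn F s x) :
    F x + μ / 2 * ‖x - y‖ ^ 2 ≤ F y := by
  have hsegment : ∀ t ∈ Set.Ioo (0 : ℝ) 1, F x + (1 - t) * (μ / 2 * ‖x - y‖ ^ 2) ≤ F y := by
    intro t ⟨ht0, ht1⟩
    have hst : 0 ≤ 1 - t := by linarith
    have hle : F x ≤ F ((1 - t) • x + t • y) :=
      hmin (hF.1 hx hy hst ht0.le (by ring))
    have hconv := hF.2 hx hy hst ht0.le (by ring)
    simp only [smul_eq_mul] at hconv
    have hgap : 0 ≤ t * (F y - (F x + (1 - t) * (μ / 2 * ‖x - y‖ ^ 2))) := by linarith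
    exact sub_nonneg.1 (nonneg_of_mul_nonneg_right hgap ht0)
  have hcont : Continuous fun t : ℝ => F x + (1 - t) * (μ / 2 * ‖x - y‖ ^ 2) := by fun_prop
  have hlim := (hcont.tendsto 0).mono_left (nhdsWithin_le_nhds (s := Set.Ioi 0))
  rw [sub_zero, one_mul] at hlim
  exact le_of_tendsto hlim (Filter.mem_of_superset (Ioo_mem_nhdsGT one_pos) hsegment)

theorem mul_dist_le_of_isMinOn [NormedSpace ℝ E] (hF : StrongConvexOn s μ F)
    (hG : StrongConvexOn s μ G) (hFG : LipschitzOnWith K (fun z => F z - G z) s) {x y : E}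
    (hx : x ∈ s) (hy : y ∈ s) (hFx : IsMinOn F s x) (hGy : IsMinOn G s y) :
    μ * dist x y ≤ K := by
  rcases (dist_nonneg (x := x) (y := y)).eq_or_lt with h0 | h0
  · simp [← h0]
  have hgrowthF := quadratic_growth_of_isMinOn hF hx hy hFx
  have hgrowthG := quadratic_growth_of_isMinOn hG hy hx hGy
  rw [← dist_eq_norm] at hgrowthF hgrowthG
  rw [dist_comm y x] at hgrowthG
  have hlip := (le_abs_self _).trans (hFG.dist_le_mul y hy x hx)
  rw [dist_comm y x] at hlip
  refine le_of_mul_le_mul_right ?_ h0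
  calc μ * dist x y * dist x y = μ / 2 * dist x y ^ 2 + μ / 2 * dist x y ^ 2 := by ring
    _ ≤ (F y - G y) - (F x - G x) := by linarith
    _ ≤ K * dist x y := hlip

theorem exists_isMinOn_add_const_mul_norm_sq [ProperSpace E] (hF : LipschitzWith K F) {c : ℝ}
    (hc : 0 < c) : ∃ x, IsMinOn (fun x => F x + c * ‖x‖ ^ 2) Set.univ x := by
  have hlower : ∀ x, F 0 + ‖x‖ * (c * ‖x‖ - K) ≤ F x + c * ‖x‖ ^ 2 := fun x => by
    have hlip := (le_abs_self _).trans (hF.dist_le_mul 0 x)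
    rw [dist_zero_left] at hlip
    linarith
  have hnorm := tendsto_norm_cocompact_atTop (E := E)
  have hcoercive : Filter.Tendsto (fun x => F x + c * ‖x‖ ^ 2) (Filter.cocompact E)
      Filter.atTop :=
    Filter.tendsto_atTop_mono hlower (Filter.tendsto_atTop_add_const_left _ _
      (hnorm.atTop_mul_atTop₀
        (Filter.tendsto_atTop_add_const_right _ _ (hnorm.const_mul_atTop hc))))
  obtain ⟨x, hx⟩ := (hF.continuous.add (by fun_prop)).exists_forall_le hcoercive
  exact ⟨x, fun y _ => hx y⟩

end StrongConvexity

section EmpiricalRiskMinimization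

variable {n d : ℕ} {f : ℝ → ℝ} {c : ℝ} {K : ℝ≥0} {D D' : Database n d}

theorem loss_eq_comp (f : ℝ → ℝ) (r : Record d) : loss f r = f ∘ (r.y • innerSL ℝ r.x) := by
  ext θ
  simp [loss, real_inner_comm]

theorem loss_lipschitzWith (hf : LipschitzWith K f) (r : Record d) :
    LipschitzWith K (loss f r) := by
  have hy : |r.y| = 1 := by rcases r.y_mem with h | h <;> simp [h]
  have hnorm : ‖r.y • innerSL ℝ r.x‖₊ = 1 := by
    ext
    simp [norm_smul, r.norm_x, hy]
  rw [loss_eq_comp]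
  simpa only [hnorm, mul_one] using hf.comp (r.y • innerSL ℝ r.x).lipschitz

theorem convexOn_loss (hf : ConvexOn ℝ Set.univ f) (r : Record d) :
    ConvexOn ℝ Set.univ (loss f r) := by
  rw [loss_eq_comp]
  exact hf.comp_linearMap (r.y • innerSL ℝ r.x).toLinearMap

/-- The unregularized part of the empirical risk. -/
def averageLoss (f : ℝ → ℝ) (D : Database n d) (θ : EuclideanSpace ℝ (Fin d)) : ℝ :=
  (1 / (n : ℝ)) * ∑ i, loss f (D i) θ

theorem empiricalRisk_eq (hn : 0 < n) (f : ℝ → ℝ) (c : ℝ) (D : Database n d) :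
    empiricalRisk f c D = fun θ => averageLoss f D θ + c * ‖θ‖ ^ 2 := by
  ext θ
  rw [empiricalRisk, averageLoss, Finset.sum_add_distrib, Finset.sum_const, Finset.card_univ,
    Fintype.card_fin, nsmul_eq_mul]
  field_simp

theorem averageLoss_lipschitzWith (hf : LipschitzWith K f) (D : Database n d) :
    LipschitzWith K (averageLoss f D) := by
  refine LipschitzWith.of_dist_le_mul fun θ θ' => ?_
  calc dist (averageLoss f D θ) (averageLoss f D θ')
      = 1 / n * |∑ i, (loss f (D i) θ - loss f (D i) θ')| := by
        rw [Real.dist_eq, averageLoss, averageLoss, ← mul_sub, ← Finset.sum_sub_distrib,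
          abs_mul, abs_of_nonneg (by positivity)]
    _ ≤ 1 / n * ∑ _i : Fin n, K * dist θ θ' := by
        gcongr
        exact (Finset.abs_sum_le_sum_abs _ _).trans
          (Finset.sum_le_sum fun i _ => (loss_lipschitzWith hf (D i)).dist_le_mul θ θ')
    _ = (n / n : ℝ) * (K * dist θ θ') := by simp; ring
    _ ≤ K * dist θ θ' := mul_le_of_le_one_left (by positivity) (div_self_le_one _)

theorem convexOn_averageLoss (hf : ConvexOn ℝ Set.univ f) (D : Database n d) :
    ConvexOn ℝ Set.univ (averageLoss f D) := by
  have hsum : ConvexOn ℝ Set.univ (∑ i, loss f (D i)) :=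
    Finset.sum_induction _ (ConvexOn ℝ Set.univ) (fun _ _ => ConvexOn.add)
      (convexOn_const 0 convex_univ) fun i _ => convexOn_loss hf (D i)
  have hsmul : averageLoss f D = fun θ => (1 / (n : ℝ)) • (∑ i, loss f (D i)) θ := by
    ext θ
    rw [averageLoss, Finset.sum_apply, smul_eq_mul]
  rw [hsmul]
  exact hsum.smul (by positivity)

theorem averageLoss_sub_lipschitzWith (hf : LipschitzWith K f) (hD : Neighbor D D') :
    LipschitzWith (2 * K / n) fun θ => averageLoss f D θ - averageLoss f D' θ := by
  obtain ⟨i, hi⟩ := hD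
  have hsub : (fun θ => averageLoss f D θ - averageLoss f D' θ) = fun θ =>
      (1 / (n : ℝ)) • (loss f (D i) θ - loss f (D' i) θ) := by
    ext θ
    rw [averageLoss, averageLoss, ← mul_sub, ← Finset.sum_sub_distrib,
      Finset.sum_eq_single i (fun j _ hj => by rw [hi j hj, sub_self]) (by simp), smul_eq_mul]
  have hcoeff : ‖1 / (n : ℝ)‖₊ * (K + K) = 2 * K / n := by
    rw [one_div, nnnorm_inv, Real.nnnorm_natCast]
    ring
  rw [hsub, ← hcoeff]
  exact (lipschitzWith_smul (1 / (n : ℝ))).comp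
    ((loss_lipschitzWith hf (D i)).sub (loss_lipschitzWith hf (D' i)))

theorem strongConvexOn_empiricalRisk (hn : 0 < n) (hf : ConvexOn ℝ Set.univ f) (c : ℝ)
    (D : Database n d) : StrongConvexOn Set.univ (2 * c) (empiricalRisk f c D) := by
  rw [strongConvexOn_iff_convex, empiricalRisk_eq hn]
  simpa using convexOn_averageLoss hf D

theorem isMinOn_erm (hn : 0 < n) (hf : LipschitzWith K f) (hc : 0 < c) (D : Database n d) :
    IsMinOn (empiricalRisk f c D) Set.univ (erm f c D) := by
  refine Classical.epsilon_spec (p := fun θ => IsMinOn (empiricalRisk f c D) Set.univ θ) ?_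
  rw [empiricalRisk_eq hn]
  exact exists_isMinOn_add_const_mul_norm_sq (averageLoss_lipschitzWith hf D) hc

theorem dist_erm_le (hconv : ConvexOn ℝ Set.univ f) (hlip : LipschitzWith K f) (hc : 0 < c)
    (hD : Neighbor D D') : dist (erm f c D) (erm f c D') ≤ K / (n * c) := by
  have hn : 0 < n := hD.choose.pos
  have hdiff : LipschitzOnWith (2 * K / n)
      (fun θ => empiricalRisk f c D θ - empiricalRisk f c D' θ) Set.univ := by
    simpa only [empiricalRisk_eq hn, add_sub_add_right_eq_sub, lipschitzOnWith_univ] using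
      averageLoss_sub_lipschitzWith hlip hD
  have hstable := mul_dist_le_of_isMinOn (strongConvexOn_empiricalRisk hn hconv c D)
    (strongConvexOn_empiricalRisk hn hconv c D') hdiff (Set.mem_univ _) (Set.mem_univ _)
    (isMinOn_erm hn hlip hc D) (isMinOn_erm hn hlip hc D')
  push_cast at hstable
  rw [le_div_iff₀ (by positivity)] at hstable ⊢
  linarith

theorem l2Sensitivity_erm_le (hconv : ConvexOn ℝ Set.univ f) (hlip : LipschitzWith K f)
    (hc : 0 < c) :
    l2Sensitivity (erm f c : Database n d → _) ≤ ENNReal.ofReal (K / (n * c)) := by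
  refine iSup₂_le fun D D' => iSup_le fun hD => ?_
  rw [edist_dist]
  exact ENNReal.ofReal_le_ofReal (dist_erm_le hconv hlip hc hD)

end EmpiricalRiskMinimization

section Algorithm

variable {n d m : ℕ} {f : ℝ → ℝ} {c φ φ₁ φ₂ φ₃ : ℝ}
  {hess : Record d → EuclideanSpace ℝ (Fin d) → Matrix (Fin d) (Fin d) ℝ}
  {sensH sensS : EuclideanSpace ℝ (Fin d) → ℝ≥0} {ci : (Fin m → ℝ) → ℝ × ℝ}

theorem outputPerturb_isAdaptivelyPrivate {Ω : Type*} [MeasurableSpace Ω] (mode : PrivacyMode)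
    (hconv : ConvexOn ℝ Set.univ f) (hlip : LipschitzWith 1 f) (hc : 0 < c) (hφ : 0 < φ) :
    IsAdaptivelyPrivate mode φ fun (D : Database n d) (_ : Ω) => outputPerturb mode f c φ D :=
  privacyNoise_isAdaptivelyPrivate mode hφ (fun _ => measurable_const) measurable_const
    fun _ => l2Sensitivity_erm_le hconv hlip hc

theorem measurable_riskHessian (hhess : ∀ r, Measurable (hess r)) (c : ℝ) (D : Database n d) :
    Measurable fun θ => riskHessian hess c θ D := by
  refine measurable_matrix_iff.2 fun j k => ?_
  simp only [riskHessian, Matrix.add_apply, Matrix.smul_apply, Matrix.sum_apply, smul_eq_mul]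
  have hentry : ∀ i, Measurable fun θ => hess (D i) θ j k := fun i =>
    (measurable_matrix_apply j k).comp (hhess (D i))
  fun_prop

theorem measurable_gradCovariance (f : ℝ → ℝ) (c : ℝ) (D : Database n d) :
    Measurable fun θ => gradCovariance f c θ D := by
  have hgrad : ∀ i, Measurable (gradient (loss f (D i))) := fun i =>
    (InnerProductSpace.toDual ℝ (EuclideanSpace ℝ (Fin d))).symm.continuous.measurable.comp
      (measurable_fderiv ℝ (loss f (D i)))
  refine measurable_matrix_iff.2 fun j k => ?_
  simp only [gradCovariance, Matrix.sub_apply, Matrix.smul_apply, Matrix.sum_apply,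
    Matrix.of_apply, smul_eq_mul]
  fun_prop

theorem measurable_intervals (hci : Measurable ci) : Measurable (intervals (d := d) ci) := by
  have hcoord : ∀ j : Fin d, Measurable fun θs : Fin m → EuclideanSpace ℝ (Fin d) =>
      ci fun i => θs i j := fun j => hci.comp (by fun_prop)
  exact ((WithLp.measurable_toLp 2 _).comp (measurable_pi_lambda _ fun j => (hcoord j).fst)).prodMk
    ((WithLp.measurable_toLp 2 _).comp (measurable_pi_lambda _ fun j => (hcoord j).snd))

theorem measurable_paramSample {Ω : Type*} [MeasurableSpace Ω] (n : ℕ)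
    {θ G β : Ω → EuclideanSpace ℝ (Fin d)} {H : Ω → Matrix (Fin d) (Fin d) ℝ}
    (hθ : Measurable θ) (hH : Measurable H) (hG : Measurable G) (hβ : Measurable β) :
    Measurable fun ω => paramSample n (θ ω) (H ω) (G ω) (β ω) := by
  have hHG : Measurable fun ω =>
      (WithLp.toLp 2 ((H ω)⁻¹.mulVec (G ω)) : EuclideanSpace ℝ (Fin d)) :=
    measurable_mulVec_toLp.comp ((measurable_matrix_inv.comp hH).prodMk hG)
  exact (hθ.add (hHG.fun_const_smul _)).sub hβ

theorem ciOutput_isAdaptivelyPrivate {Ω : Type*} [MeasurableSpace Ω] (mode : PrivacyMode)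
    (hconv : ConvexOn ℝ Set.univ f) (hlip : LipschitzWith 1 f) (hc : 0 < c)
    (hφ₁ : 0 < φ₁) (hφ₂ : 0 < φ₂) (hφ₃ : 0 < φ₃) (hhess : ∀ r, Measurable (hess r))
    (hsensH_meas : Measurable sensH) (hsensS_meas : Measurable sensS)
    (hsensH : ∀ θ, l2Sensitivity
      (fun D : Database n d => toVec (riskHessian hess c θ D)) ≤ sensH θ)
    (hsensS : ∀ θ, l2Sensitivity
      (fun D : Database n d => toVec (gradCovariance f c θ D)) ≤ sensS θ)
    (hci : Measurable ci) :
    IsAdaptivelyPrivate mode (φ₁ + φ₂ + φ₃) fun (D : Database n d) (_ : Ω) =>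
      ciOutput mode f hess sensH sensS c φ₁ φ₂ φ₃ m ci D := by
  have hθ := outputPerturb_isAdaptivelyPrivate (n := n) (d := d) (Ω := Ω) mode hconv hlip hc hφ₁
  have hH := privSPDMat_isAdaptivelyPrivate mode hφ₂ c
    (fun D : Database n d => measurable_riskHessian hhess c D) hsensH_meas hsensH
  have hS := privSPDMat_isAdaptivelyPrivate mode hφ₃ c
    (fun D : Database n d => measurable_gradCovariance f c D) hsensS_meas hsensS
  have hG : IsAdaptivelyPrivate (n := n) (d := d) mode 0 fun _ S =>
      Measure.pi fun _ : Fin m => multivariateGaussian (0 : EuclideanSpace ℝ (Fin d)) S :=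
    isAdaptivelyPrivate_const (measurable_measure_pi fun _ => measurable_multivariateGaussian 0)
  have hβ : IsAdaptivelyPrivate (n := n) (d := d) mode 0 fun _
      (p : (((Ω × EuclideanSpace ℝ (Fin d)) × Matrix (Fin d) (Fin d) ℝ) ×
        Matrix (Fin d) (Fin d) ℝ) × (Fin m → EuclideanSpace ℝ (Fin d))) =>
      (Measure.pi fun _ : Fin m => outputNoise mode n d c φ₁).map fun β =>
        intervals ci fun i => paramSample n p.1.1.1.2 p.1.1.2 (p.2 i) (β i) := by
    have : IsProbabilityMeasure (outputNoise mode n d c φ₁) :=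
      isProbabilityMeasure_privacyNoise mode _ hφ₁
    exact (isAdaptivelyPrivate_const measurable_const).map
      ((measurable_intervals hci).comp (measurable_pi_lambda _ fun i =>
        measurable_paramSample n (by fun_prop) (by fun_prop) (by fun_prop) (by fun_prop)))
  simpa [add_assoc] using! hθ.bind ((hH.comp measurable_snd).bind
    ((hS.comp (measurable_snd.comp measurable_fst)).bind ((hG.comp measurable_snd).bind hβ)))

end Algorithm

end DPCI

end

theorem mainTheorem2 {n d : ℕ} (hn : 0 < n)
    (f : ℝ → ℝ) (hf_convex : ConvexOn ℝ Set.univ f) (hf_diff : Differentiable ℝ f)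
    (hf_deriv : ∀ z, |deriv f z| ≤ 1)
    (c φ₁ φ₂ φ₃ : ℝ) (hc : 0 < c) (hφ₁ : 0 < φ₁) (hφ₂ : 0 < φ₂) (hφ₃ : 0 < φ₃)
    (hess : DPCI.Record d → EuclideanSpace ℝ (Fin d) → Matrix (Fin d) (Fin d) ℝ)
    (hhess : DPCI.IsLossHessian f hess)
    (sensH sensS : EuclideanSpace ℝ (Fin d) → ℝ≥0)
    (hsensH_meas : Measurable sensH) (hsensS_meas : Measurable sensS)
    (hsensH : ∀ θ, DPCI.l2Sensitivity
      (fun D : DPCI.Database n d => DPCI.toVec (DPCI.riskHessian hess c θ D)) ≤ sensH θ)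
    (hsensS : ∀ θ, DPCI.l2Sensitivity
      (fun D : DPCI.Database n d => DPCI.toVec (DPCI.gradCovariance f c θ D)) ≤ sensS θ)
    (m : ℕ) (α : ℝ) (hα : α ∈ Set.Ioo (0 : ℝ) 1)
    (ci : (Fin m → ℝ) → ℝ × ℝ) (hci : DPCI.IsConfidenceRule α ci) :
    DPCI.IsDifferentiallyPrivate (φ₁ + φ₂ + φ₃)
        (DPCI.ciOutput (n := n) .pureDP f hess sensH sensS c φ₁ φ₂ φ₃ m ci) ∧
      DPCI.IsZCDP (φ₁ + φ₂ + φ₃)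
        (DPCI.ciOutput (n := n) .zCDP f hess sensH sensS c φ₁ φ₂ φ₃ m ci) := by
  have hlip : LipschitzWith 1 f := lipschitzWith_of_nnnorm_deriv_le hf_diff hf_deriv
  have hpriv := fun mode => DPCI.ciOutput_isAdaptivelyPrivate (Ω := Unit) mode hf_convex hlip hc
    hφ₁ hφ₂ hφ₃ hhess.measurable hsensH_meas hsensS_meas hsensH hsensS hci.measurable
  exact ⟨(hpriv .pureDP).isDifferentiallyPrivate (), (hpriv .zCDP).isZCDP ()⟩
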